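/- Let $a, r, R \in \mathbb{R}$ with $a \ge 0$. A polynomial $f \in \mathbb{R}[x]$ is called hyperbolic if all its complex zeros are real; the zero polynomial is also deemed hyperbolic. A linear operator $T:\mathbb{R}[x]\to\mathbb{R}[x]$ is called hyperbolicity preserving if $T[f]$ is hyperbolic whenever $f$ is hyperbolic. Then $$R \in \left[0, \frac{a^2}{4}\right]$$ if and only if the operator $$T := (x+r)^2 D^2 + a(x+r) D + R, \qquad D := \frac{d}{dx},$$ is hyperbolicity preserving. -/

import Mathlib

open Polynomial

noncomputable section

/-- A real polynomial is hyperbolic if it is the zero polynomial or all its complex zeros are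
real. (In particular every constant is hyperbolic.) -/
def IsHyperbolic (f : ℝ[X]) : Prop :=
  f = 0 ∨ ∀ z : ℂ, aeval z f = 0 → z.im = 0

/-- A linear operator on `ℝ[x]` preserves hyperbolicity if it maps every hyperbolic polynomial
to a hyperbolic polynomial. -/
def PreservesHyperbolicity (T : ℝ[X] →ₗ[ℝ] ℝ[X]) : Prop :=
  ∀ f : ℝ[X], IsHyperbolic f → IsHyperbolic (T f)

/-- The linear differential operator `Q₂(x) D² + Q₁(x) D + Q₀(x)` on `ℝ[x]`, where `D = d/dx`. -/
def secondOrderOp (Q₂ Q₁ Q₀ : ℝ[X]) : ℝ[X] →ₗ[ℝ] ℝ[X] :=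
  LinearMap.mulLeft ℝ Q₂ ∘ₗ derivative ∘ₗ derivative
    + LinearMap.mulLeft ℝ Q₁ ∘ₗ derivative
    + LinearMap.mulLeft ℝ Q₀

theorem secondOrderOp_apply (Q₂ Q₁ Q₀ f : ℝ[X]) :
    secondOrderOp Q₂ Q₁ Q₀ f
      = Q₂ * derivative (derivative f) + Q₁ * derivative f + Q₀ * f := rfl

end

/-! Sufficiency: R ∈ [0, a²/4] means a = b + c and R = bc with real b, c ≥ 0. With w = z + r frozen,
T f(z) is the value at z of (wD + b)(wD + c)f. Each factor keeps the open upper half-plane free of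
zeros: there Im(p'/p) < 0, whereas wp' + bp = 0 would give p'/p = -b/w, with imaginary part ≥ 0.
Necessity comes from test polynomials: (x + r)^n((x + r)² - 1) forces R ≥ 0, and high powers of x +
r + 1 force R ≤ a²/4. -/

/-- If `p` has no zero in the open upper half-plane, then neither has `w p' + b p`, for `w` in the
open upper half-plane and `b ≥ 0`, unless it is trivially zero. -/
theorem eval_derivative_add_ne_zero_of_upper {p : ℂ[X]}
    (hp : ∀ z : ℂ, 0 < z.im → p.eval z ≠ 0) {w t : ℂ} (hw : 0 < w.im) (ht : 0 < t.im)
    {b : ℝ} (hb : 0 ≤ b) (h : b ≠ 0 ∨ derivative p ≠ 0) :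
    w * (derivative p).eval t + b * p.eval t ≠ 0 := by
  have hpt := hp t ht
  by_cases hd : derivative p = 0
  · have hb0 : (b : ℂ) ≠ 0 := by
      exact_mod_cast h.resolve_right (not_not.mpr hd)
    simpa only [hd, eval_zero, mul_zero, zero_add] using mul_ne_zero hb0 hpt
  intro h0
  have hp0 : p ≠ 0 := by
    rintro rfl
    simp at hd
  have hsum := (IsAlgClosed.splits p).eval_derivative_div_eval_of_ne_zero hpt
  have hroots : p.roots ≠ 0 := by
    intro hr
    apply hd
    have hc := IsAlgClosed.card_roots_eq_natDegree (p := p)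
    rw [hr] at hc
    rw [Polynomial.eq_C_of_natDegree_eq_zero hc.symm, derivative_C]
  have him : ∀ x ∈ p.roots, (1 / (t - x)).im < 0 := by
    intro x hx
    have hxim : x.im ≤ 0 := by
      by_contra! hlt
      exact hp x hlt ((mem_roots hp0).1 hx)
    have hne : t - x ≠ 0 := by
      intro he
      have := congrArg Complex.im he
      simp at this
      linarith
    rw [one_div, Complex.inv_im, Complex.sub_im]
    exact div_neg_of_neg_of_pos (by linarith) (Complex.normSq_pos.2 hne)
  have hneg : ((derivative p).eval t / p.eval t).im < 0 := by
    rw [hsum, ← Complex.imCLM_apply, map_multiset_sum, Multiset.map_map]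
    have := Multiset.sum_lt_sum_of_nonempty (f := fun x => (1 / (t - x)).im) (g := fun _ => 0)
      hroots him
    simpa using this
  have hw0 : w ≠ 0 := by
    rintro rfl
    simp at hw
  have heq : (derivative p).eval t / p.eval t = ((-b : ℝ) : ℂ) * w⁻¹ := by
    push_cast
    field_simp
    linear_combination h0
  rw [heq, Complex.im_ofReal_mul] at hneg
  rw [Complex.inv_im] at hneg
  have : 0 ≤ -b * (-w.im / Complex.normSq w) := by
    rw [neg_div, neg_mul_neg]
    exact mul_nonneg hb (div_nonneg hw.le (Complex.normSq_nonneg w))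
  linarith

theorem isHyperbolic_of_upper {f : ℝ[X]} (h : ∀ z : ℂ, 0 < z.im → aeval z f ≠ 0) :
    IsHyperbolic f := by
  refine Or.inr fun z hz => ?_
  rcases lt_trichotomy z.im 0 with hlt | h0 | hgt
  · refine absurd ?_ (h (starRingEnd ℂ z) (by simpa using hlt))
    rw [aeval_conj, hz, map_zero]
  · exact h0
  · exact absurd hz (h z hgt)

/-- With `b, c ≥ 0`, the operator `(x + r)² D² + (b + c) (x + r) D + b c` preserves
hyperbolicity. -/
theorem preservesHyperbolicity_secondOrderOp_of_nonneg (r : ℝ) {b c : ℝ} (hb : 0 ≤ b)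
    (hc : 0 ≤ c) (hbc : b = 0 → c = 0) :
    PreservesHyperbolicity
      (secondOrderOp ((X + C r) ^ 2) (C (b + c) * (X + C r)) (C (b * c))) := by
  intro f hf
  rcases eq_or_ne f 0 with rfl | hf0
  · exact Or.inl (map_zero _)
  have hroots := hf.resolve_left hf0
  by_cases hT : secondOrderOp ((X + C r) ^ 2) (C (b + c) * (X + C r)) (C (b * c)) f = 0
  · exact Or.inl hT
  refine isHyperbolic_of_upper fun z hz => ?_
  set F : ℂ[X] := f.map (algebraMap ℝ ℂ) with hF
  set w : ℂ := z + r with hw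
  have hwim : 0 < w.im := by simpa [hw] using hz
  have hinj : Function.Injective (algebraMap ℝ ℂ) := (algebraMap ℝ ℂ).injective
  have hFup : ∀ t : ℂ, 0 < t.im → F.eval t ≠ 0 := by
    intro t ht h0
    rw [hF, eval_map_algebraMap] at h0
    exact ht.ne' (hroots t h0)
  have hw0 : w ≠ 0 := by
    intro h0
    simp [h0] at hwim
  have hd (p : ℝ[X]) : derivative (p.map (algebraMap ℝ ℂ)) = 0 ↔ derivative p = 0 := by
    rw [derivative_map, Polynomial.map_eq_zero_iff hinj]
  have h1 : c ≠ 0 ∨ derivative F ≠ 0 := by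
    by_contra! hcon
    apply hT
    have hf' := (hd f).1 hcon.2
    simp [secondOrderOp_apply, hf', hcon.1]
  -- Here `w` is a constant, so differentiating `G` produces no derivative of x + r; this is why the
  -- factors multiply to exactly T at `z`.
  set G : ℂ[X] := C w * derivative F + C (c : ℂ) * F with hG
  have hGup : ∀ t : ℂ, 0 < t.im → G.eval t ≠ 0 := by
    intro t ht
    simpa [hG] using eval_derivative_add_ne_zero_of_upper hFup hwim ht hc h1
  have h2 : b ≠ 0 ∨ derivative G ≠ 0 := by
    by_contra! hcon
    apply hT
    have hc0 := hbc hcon.1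
    have hG' := hcon.2
    simp only [hG, hc0, Complex.ofReal_zero, map_zero, zero_mul, add_zero,
      derivative_C_mul, mul_eq_zero, C_eq_zero, hw0, false_or] at hG'
    rw [hF, derivative_map, hd] at hG'
    simp [secondOrderOp_apply, hG', hc0, hcon.1]
  have key := eval_derivative_add_ne_zero_of_upper hGup hwim hz hb h2
  convert key using 1
  simp only [hG, hF, secondOrderOp_apply, derivative_map, derivative_C_mul,
    eval_add, eval_mul, eval_C, eval_map_algebraMap, map_add, map_mul, map_pow, aeval_X, aeval_C,
    Complex.coe_algebraMap, ← hw]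
  ring

theorem IsHyperbolic.mul {f g : ℝ[X]} (hf : IsHyperbolic f) (hg : IsHyperbolic g) :
    IsHyperbolic (f * g) := by
  rcases hf with rfl | hf
  · exact Or.inl (zero_mul _)
  rcases hg with rfl | hg
  · exact Or.inl (mul_zero _)
  refine Or.inr fun z hz => ?_
  rw [map_mul, mul_eq_zero] at hz
  exact hz.elim (hf z) (hg z)

theorem isHyperbolic_X_add_C (s : ℝ) : IsHyperbolic (X + C s) := by
  refine Or.inr fun z hz => ?_
  simpa using congrArg Complex.im hz

theorem IsHyperbolic.pow {f : ℝ[X]} (hf : IsHyperbolic f) (n : ℕ) : IsHyperbolic (f ^ n) := by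
  induction n with
  | zero => exact Or.inr fun z hz => by simp at hz
  | succ n ih => simpa only [pow_succ] using ih.mul hf

theorem secondOrderOp_X_add_C_pow (a r R : ℝ) (n : ℕ) :
    secondOrderOp ((X + C r) ^ 2) (C a * (X + C r)) (C R) ((X + C r) ^ n)
      = C ((n : ℝ) * (n - 1) + a * n + R) * (X + C r) ^ n := by
  rcases n with _ | _ | n
  · simp [secondOrderOp_apply]
  · simp [secondOrderOp_apply]
    ring
  · simp [secondOrderOp_apply, derivative_X_add_C_pow]
    ring

theorem not_isHyperbolic_of_root {f : ℝ[X]} (hf : f ≠ 0) {z : ℂ} (hz : aeval z f = 0)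
    (him : z.im ≠ 0) : ¬ IsHyperbolic f :=
  fun h => him (h.resolve_left hf z hz)

/-- Consecutive terms of equal parity of the eigenvalue sequence of a hyperbolicity preserving
Euler operator do not change sign from negative to positive. -/
theorem eigenvalue_nonpos_of_neg {a r R : ℝ}
    (h : PreservesHyperbolicity (secondOrderOp ((X + C r) ^ 2) (C a * (X + C r)) (C R)))
    (n : ℕ) (hn : (n : ℝ) * (n - 1) + a * n + R < 0) :
    ((n : ℝ) + 2) * (n + 1) + a * (n + 2) + R ≤ 0 := by
  by_contra! hpos
  set α : ℝ := (n : ℝ) * (n - 1) + a * n + R with hα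
  set β : ℝ := ((n : ℝ) + 2) * (n + 1) + a * (n + 2) + R with hβ
  have hf : IsHyperbolic ((X + C r) ^ (n + 2) - (X + C r) ^ n) := by
    have := ((isHyperbolic_X_add_C r).pow n).mul
      ((isHyperbolic_X_add_C (r + 1)).mul (isHyperbolic_X_add_C (r - 1)))
    convert this using 1
    simp only [map_add, map_sub, map_one]
    ring
  have hT : secondOrderOp ((X + C r) ^ 2) (C a * (X + C r)) (C R)
      ((X + C r) ^ (n + 2) - (X + C r) ^ n) = (X + C r) ^ n * (C β * (X + C r) ^ 2 - C α) := by
    rw [map_sub, secondOrderOp_X_add_C_pow, secondOrderOp_X_add_C_pow, ← hα]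
    have : ((n + 2 : ℕ) : ℝ) * ((n + 2 : ℕ) - 1) + a * (n + 2 : ℕ) + R = β := by
      rw [hβ]
      push_cast
      ring
    rw [this]
    ring
  have hres := h _ hf
  rw [hT] at hres
  have hq : 0 < -α / β := div_pos (by linarith) hpos
  refine not_isHyperbolic_of_root (z := ⟨-r, √(-α / β)⟩) ?_ ?_ (Real.sqrt_pos.2 hq).ne' hres
  · intro h0
    have := congrArg (eval (1 - r)) h0
    simp at this
    linarith
  · have hz : (⟨-r, √(-α / β)⟩ : ℂ) + r = √(-α / β) * Complex.I := by
      apply Complex.ext <;> simp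
    have hs : ((√(-α / β) : ℝ) : ℂ) ^ 2 = ((-α / β : ℝ) : ℂ) := by
      rw [← Complex.ofReal_pow, Real.sq_sqrt hq.le]
    have hβ0 : (β : ℂ) ≠ 0 := by exact_mod_cast hpos.ne'
    simp only [map_mul, map_pow, map_add, map_sub, aeval_X, aeval_C, Complex.coe_algebraMap, hz,
      mul_pow, hs, Complex.I_sq]
    push_cast
    field_simp
    ring

/-- A negative eigenvalue at n = 0 would make every eigenvalue negative, yet they grow like n². -/
theorem nonneg_of_preservesHyperbolicity {a r R : ℝ} (ha : 0 ≤ a)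
    (h : PreservesHyperbolicity (secondOrderOp ((X + C r) ^ 2) (C a * (X + C r)) (C R))) :
    0 ≤ R := by
  by_contra! hR
  have hneg : ∀ n : ℕ, (n : ℝ) * (n - 1) + a * n + R < 0 := by
    intro n
    induction n using Nat.strong_induction_on with
    | _ n ih =>
      rcases n with _ | _ | n
      · simpa using hR
      -- Strictness comes from the next eigenvalue: it is ≤ 0, and the sequence increases strictly
      -- from n to n + 1 for n ≥ 1.
      · have := eigenvalue_nonpos_of_neg h 0 (by simpa using hR)
        push_cast at this ⊢
        linarith
      · have h0 := eigenvalue_nonpos_of_neg h n (ih n (by lia))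
        have h1 := eigenvalue_nonpos_of_neg h (n + 1) (ih (n + 1) (by lia))
        have hn : (0 : ℝ) ≤ n := n.cast_nonneg
        push_cast at h1 ⊢
        linarith
  obtain ⟨n, hn⟩ := exists_nat_gt (-R + 1)
  have := hneg n
  have hn' : 0 ≤ a * n := by positivity
  have hnn : (n : ℝ) * (n - 1) ≥ n - 1 := by nlinarith
  linarith

theorem le_sq_div_four_of_preservesHyperbolicity {a r R : ℝ} (ha : 0 ≤ a)
    (h : PreservesHyperbolicity (secondOrderOp ((X + C r) ^ 2) (C a * (X + C r)) (C R))) :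
    R ≤ a ^ 2 / 4 := by
  by_contra! hR
  have hR0 : 0 < R := lt_of_le_of_lt (by positivity) hR
  have hgap : 0 < 4 * R - a ^ 2 := by linarith
  -- With m = n + 2, the quadratic factor of T[(x + r + 1)^m] has discriminant -m(m(4R - a²) - 4R),
  -- negative for such n.
  obtain ⟨n, hn⟩ := exists_nat_gt (4 * R / (4 * R - a ^ 2))
  rw [div_lt_iff₀ hgap] at hn
  have hn0 : (0 : ℝ) ≤ n := n.cast_nonneg
  set m : ℝ := (n : ℝ) + 2 with hm
  set α : ℝ := m * (m - 1) + a * m + R with hα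
  set β : ℝ := a * m + 2 * R with hβ
  have hm1 : 0 ≤ m - 1 := by linarith
  have hm0 : 0 < m := by linarith
  have hα0 : 0 < α := by positivity
  have hdisc : 0 < 4 * α * R - β ^ 2 := by
    have e : 4 * α * R - β ^ 2 = m * (m * (4 * R - a ^ 2) - 4 * R) := by
      rw [hα, hβ]
      ring
    rw [e]
    refine mul_pos hm0 ?_
    rw [hm]
    linarith
  have hf : IsHyperbolic ((X + C (r + 1)) ^ (n + 2)) := (isHyperbolic_X_add_C _).pow _
  have hT : secondOrderOp ((X + C r) ^ 2) (C a * (X + C r)) (C R) ((X + C (r + 1)) ^ (n + 2))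
      = (X + C (r + 1)) ^ n * (C α * (X + C r) ^ 2 + C β * (X + C r) + C R) := by
    have hd1 : derivative ((X + C (r + 1)) ^ (n + 2))
        = C m * (X + C (r + 1)) ^ (n + 1) := by
      rw [derivative_X_add_C_pow, hm]
      simp
    have hd2 : derivative ((X + C (r + 1)) ^ (n + 1))
        = C (m - 1) * (X + C (r + 1)) ^ n := by
      rw [derivative_X_add_C_pow, hm]
      simp only [Nat.add_sub_cancel, Nat.cast_add, Nat.cast_one, map_add, map_sub, map_natCast,
        map_ofNat, map_one]
      ring
    rw [secondOrderOp_apply, hd1, derivative_C_mul, hd2]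
    simp only [hα, hβ, map_add, map_sub, map_mul, map_one, map_ofNat]
    ring
  have hres := h _ hf
  rw [hT] at hres
  set s : ℝ := √(4 * α * R - β ^ 2) with hs
  have hs0 : 0 < s := Real.sqrt_pos.2 hdisc
  have hs2 : (s : ℂ) ^ 2 = 4 * α * R - β ^ 2 := by
    have : s ^ 2 = 4 * α * R - β ^ 2 := Real.sq_sqrt hdisc.le
    exact_mod_cast this
  refine not_isHyperbolic_of_root (z := ⟨-β / (2 * α) - r, s / (2 * α)⟩) ?_ ?_
    (div_pos hs0 (by positivity)).ne' hres
  · intro h0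
    have := congrArg (eval (-r)) h0
    simp at this
    exact hR0.ne' this
  · have hα' : (α : ℂ) ≠ 0 := by exact_mod_cast hα0.ne'
    have hz : (⟨-β / (2 * α) - r, s / (2 * α)⟩ : ℂ) + r = (-β + s * Complex.I) / (2 * α) := by
      rw [Complex.mk_eq_add_mul_I]
      push_cast
      ring
    rw [map_mul, mul_eq_zero]
    right
    simp only [map_mul, map_pow, map_add, aeval_X, aeval_C, Complex.coe_algebraMap, hz]
    field_simp
    linear_combination hs2 * Complex.I ^ 2 + (4 * α * R - β ^ 2) * Complex.I_sq

theorem mainTheorem4 (a r R : ℝ) (ha : 0 ≤ a) :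
    R ∈ Set.Icc 0 (a ^ 2 / 4) ↔
      PreservesHyperbolicity
        (secondOrderOp ((X + C r) ^ 2) (C a * (X + C r)) (C R)) := by
  refine ⟨fun ⟨h0, h1⟩ => ?_, fun h =>
    ⟨nonneg_of_preservesHyperbolicity ha h, le_sq_div_four_of_preservesHyperbolicity ha h⟩⟩
  have hdisc : 0 ≤ a ^ 2 - 4 * R := by linarith
  have hs2 := Real.sq_sqrt hdisc
  have hs0 := Real.sqrt_nonneg (a ^ 2 - 4 * R)
  have hsa : √(a ^ 2 - 4 * R) ≤ a := Real.sqrt_le_iff.2 ⟨ha, by linarith⟩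
  set s : ℝ := √(a ^ 2 - 4 * R)
  -- Taking the larger root as `b` ensures that b = 0 forces c = 0.
  have key := preservesHyperbolicity_secondOrderOp_of_nonneg r (b := (a + s) / 2)
    (c := (a - s) / 2) (by linarith) (by linarith) (fun _ => by linarith)
  have e1 : (a + s) / 2 + (a - s) / 2 = a := by ring
  have e2 : (a + s) / 2 * ((a - s) / 2) = R := by linear_combination -hs2 / 4
  rwa [e1, e2] at key
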